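/- Let $J$ be a euclidean Jordan algebra, i.e. a finite-dimensional real vector space with a commutative bilinear product satisfying $a(ba^2)=(ab)a^2$ for all $a,b\in J$ and such that $a^2+b^2=0$ implies $a=b=0$; such an algebra has a unit $e$. Every $x\in J$ can be written $x=\sum_{i=1}^r\lambda_ip_i$ with $\lambda_i\in\mathbb{R}$ and $(p_i)_{i=1}^r$ a Jordan frame (mutually orthogonal primitive idempotents with sum $e$), and the $\lambda_i$, the eigenvalues of $x$, are determined by $x$ up to order. Put $$\exp(x)=\sum_i e^{\lambda_i}p_i,\quad \operatorname{tr}(x)=\sum_i\lambda_i,\quad \|x\|=\sup_i|\lambda_i|,\quad \|x\|_\sigma=\sup_{i,j}|\lambda_i-\lambda_j|,$$ and let $J_0=\{u\in J:\operatorname{tr}(u)=0\}$. Let $\mathcal{C}\subset J$ be the cone of the elements all of whose eigenvalues are positive. For $P,Q\in\mathcal{C}$ let $M(P,Q)=\inf\{t>0: tQ-P\in\mathcal{C}\}$, and let $d_T(P,Q)=\log\max(M(P,Q),M(Q,P))$ and $d_H(P,Q)=\log\big(M(P,Q)M(Q,P)\big)$ be the Thompson metric and the Hilbert pseudo-metric.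 For $\lambda>0$ put $$d_T^\lambda(u,v)=\tfrac1\lambda\, d_T(\exp(\lambda u),\exp(\lambda v))\quad(u,v\in J),\qquad d_H^\lambda(u_0,v_0)=\tfrac1\lambda\, d_H(\exp(\lambda u_0),\exp(\lambda v_0))\quad(u_0,v_0\in J_0).$$ Then $\|\cdot\|$ is a norm on $J$, the set $J_0$ is a linear subspace of $J$, $\|\cdot\|_\sigma$ is a norm on $J_0$, and for all $u,v\in J$ and all $u_0,v_0\in J_0$ $$\lim_{\lambda\to0^+}d_T^\lambda(u,v)=\|v-u\|,\qquad \lim_{\lambda\to0^+}d_H^\lambda(u_0,v_0)=\|u_0-v_0\|_\sigma .$$ -/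

import Mathlib

open Filter Topology

namespace EuclideanJordan

section Algebra

variable {J : Type*} [NonUnitalNonAssocCommRing J] [Module ℝ J]

/-- A primitive idempotent: a nonzero idempotent that is not the sum of two nonzero orthogonal
idempotents. -/
def IsPrimitiveIdempotent (p : J) : Prop :=
  p * p = p ∧ p ≠ 0 ∧
    ∀ q r : J, q * q = q → r * r = r → q * r = 0 → p = q + r → q = 0 ∨ r = 0

/-- A Jordan frame: mutually orthogonal primitive idempotents whose sum is the unit of the
algebra. -/
def IsJordanFrame {r : ℕ} (p : Fin r → J) : Prop :=
  (∀ i, IsPrimitiveIdempotent (p i)) ∧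
    (∀ i j, i ≠ j → p i * p j = 0) ∧
    (∀ y : J, (∑ i, p i) * y = y)

/-- A spectral decomposition `x = ∑ i, eigenvalue i • frame i` along a Jordan frame. -/
structure SpectralDecomposition (x : J) where
  rank : ℕ
  frame : Fin rank → J
  eigenvalue : Fin rank → ℝ
  isJordanFrame : IsJordanFrame frame
  eq_sum : x = ∑ i, eigenvalue i • frame i

/-- The set of eigenvalues of `x`. -/
def spec (x : J) : Set ℝ :=
  {μ | ∃ (d : SpectralDecomposition x) (i : Fin d.rank), d.eigenvalue i = μ}

open Classical in
/-- `exp x = ∑ i, exp (λ i) • p i` for a spectral decomposition `x = ∑ i, λ i • p i`. In a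
euclidean Jordan algebra a decomposition exists and the value does not depend on it. -/
noncomputable def exp (x : J) : J :=
  if h : Nonempty (SpectralDecomposition x) then
    ∑ i, Real.exp (h.some.eigenvalue i) • h.some.frame i
  else 0

open Classical in
/-- The trace `∑ i, λ i` for a spectral decomposition `x = ∑ i, λ i • p i`. In a euclidean Jordan
algebra a decomposition exists and the value does not depend on it. -/
noncomputable def trace (x : J) : ℝ :=
  if h : Nonempty (SpectralDecomposition x) then ∑ i, h.some.eigenvalue i else 0

/-- The spectral norm, the supremum of the `|μ|` over the eigenvalues `μ` (`0` if `J = 0`). -/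
noncomputable def specNorm (x : J) : ℝ :=
  sSup {s | ∃ μ ∈ spec x, s = |μ|}

/-- The diameter of the spectrum (`0` if `J = 0`). -/
noncomputable def specDiam (x : J) : ℝ :=
  sSup {s | ∃ μ ∈ spec x, ∃ ν ∈ spec x, s = |μ - ν|}

variable (J) in
/-- The symmetric cone of `J`: the elements all of whose eigenvalues are positive. -/
def cone : Set J := {x | ∀ μ ∈ spec x, 0 < μ}

/-- `M(P, Q) = inf {t > 0 | t Q - P ∈ C}`. -/
noncomputable def gaugeM (P Q : J) : ℝ := sInf {t : ℝ | 0 < t ∧ t • Q - P ∈ cone J}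

/-- The Thompson metric (meaningful on the cone). -/
noncomputable def thompson (P Q : J) : ℝ := Real.log (max (gaugeM P Q) (gaugeM Q P))

/-- The Hilbert pseudo-metric (meaningful on the cone). -/
noncomputable def hilbert (P Q : J) : ℝ := Real.log (gaugeM P Q * gaugeM Q P)

/-- The pull-back of `d_T / t` along `u ↦ exp (t u)`. -/
noncomputable def thompsonScaled (t : ℝ) (u v : J) : ℝ :=
  thompson (exp (t • u)) (exp (t • v)) / t

/-- The pull-back of `d_H / t` along `u ↦ exp (t u)`. -/
noncomputable def hilbertScaled (t : ℝ) (u v : J) : ℝ :=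
  hilbert (exp (t • u)) (exp (t • v)) / t

end Algebra

/-- `N` is a norm on the real vector space `E`. -/
def IsNorm {E : Type*} [AddCommGroup E] [Module ℝ E] (N : E → ℝ) : Prop :=
  ∃ p : Seminorm ℝ E, (∀ x, p x = N x) ∧ ∀ x, N x = 0 → x = 0

end EuclideanJordan

namespace EuclideanJordan

set_option linter.unusedSectionVars false

/-! Write `Λ` for the largest eigenvalue and `τ(x) = Tr L(x)`, where `L(x)` is multiplication by
`x`. Both norms and both metrics are governed by `Λ`: `‖x‖ = max (Λ x) (Λ (-x))`, `‖x‖_σ = Λ x + Λ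
(-x)`, and `x` lies in the cone iff `Λ (-x) < 0`.

The algebra serves to make `Λ` sublinear. The form `τ(xy)` is associative, because `L` of an
associator is a commutator, and it is positive definite, because formal reality makes every element
a combination of orthogonal idempotents and `τ ≥ 1` on nonzero idempotents. Hence `Λ x` is the
supremum of the Rayleigh quotients `τ((xy)y) / τ(yy)` (`maxEigenvalue_le_iff`), a supremum of linear
functions of `x` that involves no choice of decomposition. Linearity of the trace is separate: it
rests on nonorthogonal primitive idempotents having equal `τ` (`mulTrace_eq_of_primitive`).

For the limits, `exp (t u) = e + t u + O(t²)`, so `Λ (exp (t u) - e^{ts} exp (t v)) = t (Λ (u - v) -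
s) + o(t)`. Its sign decides whether `e^{ts}` is admissible in the gauge, so `log M(exp (t u), exp
(t v)) / t → Λ (u - v)`. Exchanging `u` and `v` and taking the maximum or the sum gives the two
limits. -/

open Polynomial

/-! ### Polynomials with simple real roots -/

/-- A real polynomial `m` such that `m ∣ X (f² + g²)` implies `m ∣ f` has only simple, nonzero,
real roots. -/
theorem exists_finset_dvd_iff_of_dvd_sum_sq {m : ℝ[X]} (hm : m ≠ 0)
    (h : ∀ f g : ℝ[X], m ∣ X * (f * f + g * g) → m ∣ f) :
    ∃ s : Finset ℝ, 0 ∉ s ∧ ∀ f : ℝ[X], m ∣ f ↔ ∀ a ∈ s, f.eval a = 0 := by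
  have hsq : Squarefree m := by
    intro d hd
    obtain ⟨n, hn⟩ := hd
    have h1 : m ∣ d * n := h (d * n) 0 ⟨X * n, by rw [hn]; ring⟩
    obtain ⟨k, hk⟩ := h1
    have h2 : d * n * (d * k - 1) = 0 := by
      have : d * n = d * d * n * k := by rw [← hn]; exact hk
      linear_combination -this
    have h3 : d * n ≠ 0 := by
      intro h0
      apply hm
      rw [hn, mul_assoc, h0, mul_zero]
    have h4 := (mul_eq_zero.mp h2).resolve_left h3
    exact IsUnit.of_mul_eq_one k (by linear_combination h4)
  have hquad : ∀ a b : ℝ, b ≠ 0 → ¬ ((X - C a) * (X - C a) + C (b * b)) ∣ m := by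
    rintro a b hb ⟨n, hn⟩
    -- If `m = ((X - a)² + b²) n`, then `(b n)² + ((X - a) n)² = m n`, so `m` divides `b n`, whose
    -- degree is too small.
    have h1 : m ∣ C b * n := h (C b * n) ((X - C a) * n) ⟨X * n, by
      rw [hn, C_mul]; ring⟩
    have hn0 : n ≠ 0 := by rintro rfl; simp at hn; exact hm hn
    have hCb : (C b : ℝ[X]) ≠ 0 := by simpa using hb
    have h2 := natDegree_le_of_dvd h1 (mul_ne_zero hCb hn0)
    rw [natDegree_C_mul hb] at h2
    have hdeg : ((X - C a) * (X - C a) + C (b * b) : ℝ[X]).natDegree = 2 := by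
      compute_degree!
    have hq0 : ((X - C a) * (X - C a) + C (b * b) : ℝ[X]) ≠ 0 := by
      intro h0; rw [h0] at hdeg; simp at hdeg
    rw [hn, natDegree_mul hq0 hn0, hdeg] at h2
    omega
  have hspl : m.Splits := by
    refine Splits.of_splits_map (algebraMap ℝ ℂ) (IsAlgClosed.splits _) fun z hz => ?_
    rw [mem_roots (map_ne_zero hm), IsRoot, eval_map_algebraMap] at hz
    by_cases him : z.im = 0
    · exact ⟨z.re, by apply Complex.ext <;> simp [him]⟩
    · refine absurd ?_ (hquad z.re z.im him)
      convert m.quadratic_dvd_of_aeval_eq_zero_im_ne_zero hz him using 1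
      rw [Complex.sq_norm, Complex.normSq_apply]
      simp only [C_mul, C_add, map_ofNat]
      ring
  have hnd : m.roots.Nodup := nodup_roots (PerfectField.separable_iff_squarefree.mpr hsq)
  refine ⟨m.roots.toFinset, ?_, fun f => ?_⟩
  · intro h0
    simp only [Multiset.mem_toFinset, mem_roots hm, IsRoot] at h0
    obtain ⟨n, hn⟩ := dvd_iff_isRoot.mpr h0
    simp only [map_zero, sub_zero] at hn
    have h1 : m ∣ n := h n 0 ⟨n, by rw [hn]; ring⟩
    have hn0 : n ≠ 0 := by rintro rfl; simp at hn; exact hm hn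
    have h2 := natDegree_le_of_dvd h1 hn0
    rw [hn, natDegree_mul X_ne_zero hn0, natDegree_X] at h2
    omega
  · by_cases hf : f = 0
    · simp [hf]
    rw [hspl.dvd_iff_roots_le_roots hm hf, Multiset.le_iff_subset hnd]
    simp only [Multiset.subset_iff, Multiset.mem_toFinset, mem_roots hm, mem_roots hf, IsRoot]

/-! ### Power associativity and spectral idempotents -/

section Jordan

variable {J : Type*} [NonUnitalNonAssocCommRing J] [Module ℝ J]
  [IsScalarTower ℝ J J] [SMulCommClass ℝ J J]

/-- Multiplication by `x`, as a linear endomorphism. -/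
noncomputable abbrev mulOp (x : J) : Module.End ℝ J := LinearMap.mulLeft ℝ x

section Identities

variable [IsCommJordan J]

/-- The full linearization of the Jordan identity. -/
theorem jordan_linearized (x y z w : J) :
    (x * y) * (z * w) + (y * z) * (x * w) + (z * x) * (y * w)
      = z * ((x * y) * w) + x * ((y * z) * w) + y * ((z * x) * w) := by
  have h := congrArg (fun f : AddMonoid.End J => f w)
    (two_nsmul_lie_lmul_lmul_add_add_eq_zero x y z)
  simp only [Ring.lie_def, two_nsmul] at h
  change (x * ((y * z) * w) - (y * z) * (x * w) + (y * ((z * x) * w) - (z * x) * (y * w))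
    + (z * ((x * y) * w) - (x * y) * (z * w))) + (x * ((y * z) * w) - (y * z) * (x * w)
    + (y * ((z * x) * w) - (z * x) * (y * w)) + (z * ((x * y) * w) - (x * y) * (z * w))) = 0 at h
  rw [← two_smul ℝ, smul_eq_zero] at h
  have h' := h.resolve_left two_ne_zero
  rw [← sub_eq_zero, ← neg_eq_zero, ← h']
  abel

/-- Multiplication by `(x y) w` in terms of multiplications by shorter products. -/
theorem mulOp_mul_mul (x y w : J) :
    mulOp ((x * y) * w) = mulOp (x * y) * mulOp w + mulOp (x * w) * mulOp y
      + mulOp (y * w) * mulOp x - mulOp x * mulOp w * mulOp y - mulOp y * mulOp w * mulOp x := by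
  ext z
  -- The linearized identity is read as an operator identity in `z`.
  have h := jordan_linearized x y z w
  simp only [LinearMap.mulLeft_apply, LinearMap.add_apply, LinearMap.sub_apply,
    Module.End.mul_apply]
  rw [mul_comm w z, mul_comm y z, mul_comm x z, mul_comm (x * y * w) z, mul_comm w (z * y),
    mul_comm w (z * x), mul_comm (x * w), mul_comm (y * w)]
  rw [mul_comm y z] at h
  rw [← sub_eq_zero] at h ⊢
  rw [← neg_eq_zero, ← h]
  abel

/-- Multiplication by an associator is a double commutator. -/
theorem mulOp_associator (x y z : J) :
    mulOp ((x * y) * z) - mulOp (x * (y * z))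
      = mulOp y * (mulOp x * mulOp z - mulOp z * mulOp x)
        - (mulOp x * mulOp z - mulOp z * mulOp x) * mulOp y := by
  rw [mul_comm x (y * z), mulOp_mul_mul x y z, mulOp_mul_mul y z x, mul_comm z x, mul_comm y x]
  noncomm_ring

theorem commute_mulOp_mul_self (x : J) : Commute (mulOp x) (mulOp (x * x)) :=
  LinearMap.ext fun y => (IsJordan.lmul_lmul_comm_lmul x y).symm

end Identities

/-- `jpow x n` is the power `x ^ (n + 1)`. -/
def jpow (x : J) : ℕ → J
  | 0 => x
  | n + 1 => x * jpow x n

variable [IsCommJordan J]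

/-- Since `x^{n+3} = (x^{n+1} x) x`, `mulOp_mul_mul` expresses `L(x^{n+3})` through `L(x)`, `L(x²)`,
`L(x^{n+1})` and `L(x^{n+2})`, all of which commute with `L(x)`. -/
theorem commute_mulOp_jpow (x : J) (n : ℕ) : Commute (mulOp x) (mulOp (jpow x n)) := by
  induction n using Nat.twoStepInduction with
  | zero => exact Commute.refl _
  | one => exact commute_mulOp_mul_self x
  | more n h1 h2 =>
    have hx : jpow x (n + 2) = (jpow x n * x) * x := by
      rw [mul_comm _ x, mul_comm (jpow x n)]; rfl
    have hx' : jpow x n * x = jpow x (n + 1) := mul_comm _ _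
    rw [hx, mulOp_mul_mul, hx']
    have h3 := commute_mulOp_mul_self x
    have h4 := Commute.refl (mulOp x)
    exact ((((h2.mul_right h4).add_right (h2.mul_right h4)).add_right (h3.mul_right h1)).sub_right
      ((h1.mul_right h4).mul_right h4)).sub_right ((h4.mul_right h4).mul_right h1)

theorem jpow_mul_jpow (x : J) (m n : ℕ) : jpow x m * jpow x n = jpow x (m + n + 1) := by
  induction n with
  | zero => exact mul_comm _ _
  | succ n ih =>
    have h := LinearMap.congr_fun (commute_mulOp_jpow x m).eq (jpow x n)
    simp only [Module.End.mul_apply, LinearMap.mulLeft_apply] at h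
    change jpow x m * (x * jpow x n) = x * jpow x (m + n + 1)
    rw [← h, ih]

/-- The evaluation `f ↦ (X f)(x)`. -/
noncomputable def evalX (x : J) : ℝ[X] →ₗ[ℝ] J :=
  Polynomial.lsum fun n => LinearMap.toSpanSingleton ℝ J (jpow x n)

theorem evalX_monomial (x : J) (n : ℕ) (a : ℝ) : evalX x (monomial n a) = a • jpow x n := by
  simp [evalX, Polynomial.lsum_apply, sum_monomial_index]

/-- This is `(X f)(X g) = X (X f g)`. Keeping a factor `X` avoids constant terms, as no unit is
available yet. -/
theorem evalX_mul_evalX (x : J) (f g : ℝ[X]) : evalX x f * evalX x g = evalX x (X * (f * g)) := by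
  induction f using Polynomial.induction_on' with
  | add f₁ f₂ h₁ h₂ => simp only [map_add, add_mul, h₁, h₂, mul_add]
  | monomial m a =>
    induction g using Polynomial.induction_on' with
    | add g₁ g₂ h₁ h₂ => simp only [map_add, mul_add, h₁, h₂]
    | monomial n b =>
      rw [monomial_mul_monomial, X_mul_monomial, evalX_monomial, evalX_monomial, evalX_monomial,
        smul_mul_smul_comm, jpow_mul_jpow]

theorem evalX_mem {x : J} {S : Submodule ℝ J} (hx : x ∈ S) (hS : ∀ a ∈ S, ∀ b ∈ S, a * b ∈ S)
    (f : ℝ[X]) : evalX x f ∈ S := by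
  have hp : ∀ n, jpow x n ∈ S := fun n => by
    induction n with
    | zero => exact hx
    | succ n ih => exact hS _ hx _ ih
  induction f using Polynomial.induction_on' with
  | add f g hf hg => rw [map_add]; exact S.add_mem hf hg
  | monomial n a => rw [evalX_monomial]; exact S.smul_mem _ (hp n)

/-- In a formally real Jordan algebra every element is a combination of orthogonal idempotents,
which lie in every subalgebra containing it. -/
theorem exists_orthogonal_idempotents [FiniteDimensional ℝ J]
    (hreal : ∀ a b : J, a * a + b * b = 0 → a = 0 ∧ b = 0) (x : J) :
    ∃ (s : Finset ℝ) (q : ℝ → J), (∀ a ∈ s, q a * q a = q a) ∧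
      (∀ a ∈ s, ∀ b ∈ s, a ≠ b → q a * q b = 0) ∧ x = ∑ a ∈ s, a • q a ∧
      ∀ S : Submodule ℝ J, x ∈ S → (∀ a ∈ S, ∀ b ∈ S, a * b ∈ S) → ∀ a, q a ∈ S := by
  let I : Ideal ℝ[X] :=
    { carrier := {f | evalX x f = 0}
      add_mem' := fun {f g} hf hg => by
        simp only [Set.mem_ofPred_eq] at hf hg ⊢
        rw [map_add, hf, hg, add_zero]
      zero_mem' := map_zero _
      -- The square of `(X c f)(x)` has the factor `(X f)(x) = 0`; formal reality removes the
      -- square.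
      smul_mem' := fun c f hf => by
        simp only [Set.mem_ofPred_eq, smul_eq_mul] at hf ⊢
        have h0 : evalX x (c * f) * evalX x (c * f) + 0 * 0 = 0 := by
          rw [evalX_mul_evalX, show X * (c * f * (c * f)) = X * (f * (c * c * f)) by ring,
            ← evalX_mul_evalX, hf]
          simp
        exact (hreal _ _ h0).1 }
  obtain ⟨m, hm⟩ := IsPrincipalIdealRing.principal I
  have hmem : ∀ f, evalX x f = 0 ↔ m ∣ f := fun f => by
    rw [← Ideal.mem_span_singleton, ← Ideal.submodule_span_eq, ← hm]; rfl
  have hm0 : m ≠ 0 := by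
    rintro rfl
    have hinj : Function.Injective (evalX x) := by
      rw [injective_iff_map_eq_zero]
      intro f hf
      simpa using (hmem f).mp hf
    have := Module.Finite.of_injective (evalX x) hinj
    exact Polynomial.not_finite this
  obtain ⟨s, hs0, hs⟩ := exists_finset_dvd_iff_of_dvd_sum_sq hm0 (fun f g hfg => by
    rw [← hmem, mul_add, map_add, ← evalX_mul_evalX, ← evalX_mul_evalX] at hfg
    exact (hmem f).mp (hreal _ _ hfg).1)
  have heq : ∀ f g : ℝ[X], (∀ a ∈ s, f.eval a = g.eval a) → evalX x f = evalX x g := by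
    intro f g h
    rw [← sub_eq_zero, ← map_sub, hmem, hs]
    intro a ha
    rw [eval_sub, h a ha, sub_self]
  -- The factor `a⁻¹` makes `X * l a` the indicator of `a` on `s`, so that `q a = (X * l a)(x)` is
  -- idempotent. It is legitimate because `0 ∉ s`.
  let l : ℝ → ℝ[X] := fun a => C a⁻¹ * Lagrange.basis s id a
  have hself : ∀ a ∈ s, (l a).eval a = a⁻¹ := fun a ha => by
    have := Lagrange.eval_basis_self (v := id) (Function.injective_id.injOn) ha
    simp only [id] at this
    simp [l, this]
  have hne : ∀ a, ∀ b ∈ s, a ≠ b → (l a).eval b = 0 := fun a b hb hab => by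
    have := Lagrange.eval_basis_of_ne (v := id) hab hb
    simp only [id] at this
    simp [l, this]
  refine ⟨s, fun a => evalX x (l a), fun a ha => ?_, fun a ha b hb hab => ?_, ?_,
    fun S hx hS a => evalX_mem hx hS _⟩
  · rw [evalX_mul_evalX]
    refine heq _ _ fun b hb => ?_
    rcases eq_or_ne a b with rfl | hab
    · have ha0 : a ≠ 0 := fun h => hs0 (h ▸ ha)
      simp [hself a ha, ha0]
    · simp [hne a b hb hab]
  · rw [evalX_mul_evalX, ← map_zero (evalX x)]
    refine heq _ _ fun c hc => ?_
    rcases eq_or_ne a c with rfl | hac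
    · simp [hne b a hc hab.symm]
    · simp [hne a c hc hac]
  · have hx : x = evalX x 1 := by
      rw [← monomial_zero_one, evalX_monomial, one_smul]; rfl
    conv_lhs => rw [hx]
    simp only [← map_smul, ← map_sum]
    refine heq _ _ fun b hb => ?_
    have hb0 : b ≠ 0 := fun h => hs0 (h ▸ hb)
    rw [eval_finsetSum, Finset.sum_eq_single_of_mem b hb]
    · simp [hself b hb, hb0]
    · intro a _ hab
      simp [hne a b hb hab]

end Jordan

section Jordan

variable {J : Type*} [NonUnitalNonAssocCommRing J] [Module ℝ J]
  [IsScalarTower ℝ J J] [SMulCommClass ℝ J J] [IsCommJordan J]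

/-! ### Peirce decomposition of an idempotent -/

section Peirce

variable {p : J}

/-- Setting all three variables equal to `p` in `mulOp_mul_mul` shows that `L(p)` is annihilated by
`t (2t - 1) (t - 1)`. The Peirce projections are the Lagrange polynomials `2t² - t` and `4(t - t²)`
in `L(p)`. -/
theorem mulOp_idempotent_cubic (hp : p * p = p) :
    mulOp p = 3 • (mulOp p * mulOp p) - 2 • (mulOp p * mulOp p * mulOp p) := by
  have h := mulOp_mul_mul p p p
  rw [hp, hp] at h
  conv_lhs => rw [h]
  noncomm_ring

theorem idempotent_mul_mul_mul (hp : p * p = p) (y : J) :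
    (2 : ℝ) • (p * (p * (p * y))) = (3 : ℝ) • (p * (p * y)) - p * y := by
  have h := LinearMap.congr_fun (mulOp_idempotent_cubic hp) y
  simp only [LinearMap.sub_apply, LinearMap.smul_apply, Module.End.mul_apply,
    LinearMap.mulLeft_apply] at h
  rw [← sub_eq_zero] at h ⊢
  rw [← h]
  module

variable (p) in
/-- The Peirce projection of an idempotent `p` onto `{y | p y = y}`. -/
noncomputable def peirceOne : Module.End ℝ J := (2 : ℝ) • (mulOp p * mulOp p) - mulOp p

variable (p) in
/-- The Peirce projection of an idempotent `p` onto `{y | p y = y / 2}`. -/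
noncomputable def peirceHalf : Module.End ℝ J := (4 : ℝ) • (mulOp p - mulOp p * mulOp p)

theorem peirceOne_apply (y : J) : peirceOne p y = (2 : ℝ) • (p * (p * y)) - p * y := rfl

theorem peirceHalf_apply (y : J) : peirceHalf p y = (4 : ℝ) • (p * y - p * (p * y)) := rfl

theorem mul_eq_peirce (y : J) : p * y = peirceOne p y + (2⁻¹ : ℝ) • peirceHalf p y := by
  rw [peirceOne_apply, peirceHalf_apply]; module

theorem mul_peirceOne (hp : p * p = p) (y : J) : p * peirceOne p y = peirceOne p y := by
  rw [peirceOne_apply, mul_sub, mul_smul_comm, idempotent_mul_mul_mul hp]; module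

theorem mul_peirceHalf (hp : p * p = p) (y : J) :
    p * peirceHalf p y = (2⁻¹ : ℝ) • peirceHalf p y := by
  have h := idempotent_mul_mul_mul hp y
  rw [peirceHalf_apply, mul_smul_comm, mul_sub,
    show (4 : ℝ) • (p * (p * y) - p * (p * (p * y)))
      = (4 : ℝ) • (p * (p * y)) - (2 : ℝ) • (2 : ℝ) • (p * (p * (p * y))) by module, h]
  module

theorem peirceOne_of_mul_eq {y : J} {c : ℝ} (h : p * y = c • y) :
    peirceOne p y = (2 * c * c - c) • y := by
  rw [peirceOne_apply, h, mul_smul_comm, h]; module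

theorem peirceHalf_of_mul_eq {y : J} {c : ℝ} (h : p * y = c • y) :
    peirceHalf p y = (4 * (c - c * c)) • y := by
  rw [peirceHalf_apply, h, mul_smul_comm, h]; module

theorem peirceOne_idem (hp : p * p = p) (y : J) :
    peirceOne p (peirceOne p y) = peirceOne p y := by
  rw [peirceOne_of_mul_eq (c := 1) (by rw [mul_peirceOne hp, one_smul])]; module

theorem peirceHalf_idem (hp : p * p = p) (y : J) :
    peirceHalf p (peirceHalf p y) = peirceHalf p y := by
  rw [peirceHalf_of_mul_eq (mul_peirceHalf hp y)]; module

/-- Multiplications by elements of the Peirce spaces `1` and `0` commute with multiplication by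
the idempotent. -/
theorem idempotent_mul_mul_comm (hp : p * p = p) {a : J} (ha : p * a = a ∨ p * a = 0) (w : J) :
    p * (a * w) = a * (p * w) := by
  have h := jordan_linearized p p a w
  rw [hp, mul_comm a p] at h
  rcases ha with ha | ha
  · rw [ha] at h
    have h2 : a * (p * w) - p * (a * w) = 0 := by
      rw [← sub_eq_zero] at h
      rw [← h]
      abel
    rw [sub_eq_zero] at h2
    exact h2.symm
  · rw [ha] at h
    simpa using h

/-- The quadratic identity `P(p) P(q) p = (P(p) q)²` for idempotents. -/
theorem peirceOne_peirceOne_idempotent (hp : p * p = p) {q : J} (hq : q * q = q) :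
    peirceOne p (peirceOne q p) = peirceOne p q * peirceOne p q := by
  -- Here `q = a + b + c` is the decomposition for the eigenvalues `1`, `1/2`, `0` of `L(p)`.
  obtain ⟨a, ha⟩ : ∃ a, a = peirceOne p q := ⟨_, rfl⟩
  obtain ⟨b, hb⟩ : ∃ b, b = peirceHalf p q := ⟨_, rfl⟩
  obtain ⟨c, hc⟩ : ∃ c, c = q - a - b := ⟨_, rfl⟩
  have hpq : p * q = a + (2⁻¹ : ℝ) • b := by rw [ha, hb, mul_eq_peirce]
  have hpa : p * a = a := by rw [ha, mul_peirceOne hp]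
  have hpb : p * b = (2⁻¹ : ℝ) • b := by rw [hb, mul_peirceHalf hp]
  have hpc : p * c = 0 := by
    rw [hc, mul_sub, mul_sub, hpa, hpb, hpq]; module
  have hqabc : q = a + b + c := by rw [hc]; abel
  have hcomma := idempotent_mul_mul_comm hp (Or.inl hpa)
  have hcommc := idempotent_mul_mul_comm hp (Or.inr hpc)
  have haa : peirceOne p (a * a) = a * a := by
    rw [peirceOne_of_mul_eq (c := 1) (by rw [hcomma, hpa, one_smul])]; module
  have hac : a * c = 0 := by
    have h1 := hcomma c
    have h2 := hcommc a
    rw [hpc, mul_zero] at h1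
    rw [hpa, mul_comm c a, h1] at h2
    exact h2.symm
  have hab : peirceOne p (a * b) = 0 := by
    rw [peirceOne_of_mul_eq (c := 2⁻¹) (by rw [hcomma, hpb, mul_smul_comm])]; module
  have hcb : peirceOne p (c * b) = 0 := by
    rw [peirceOne_of_mul_eq (c := 2⁻¹) (by rw [hcommc, hpb, mul_smul_comm])]; module
  have hcc : peirceOne p (c * c) = 0 := by
    rw [peirceOne_of_mul_eq (c := 0) (by rw [hcommc, hpc, mul_zero, zero_smul])]; module
  -- Comparing components in the `1`-space of `q² = q` gives `a = a² + (b²)₁`. Below, that of `P(q)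
  -- p` is `2a² + (b²)₁ - a`, hence `a²`.
  have hqq : peirceOne p q = a * a + peirceOne p (b * b) := by
    have h1 : q * q = a * a + (2 : ℝ) • (a * b) + (2 : ℝ) • (c * b) + c * c + b * b := by
      rw [hqabc]
      simp only [add_mul, mul_add, mul_comm c a, mul_comm b a, hac, mul_comm b c]
      module
    conv_lhs => rw [← hq, h1]
    simp only [map_add, map_smul, haa, hab, hcb, hcc]
    module
  have hqp : peirceOne q p = (2 : ℝ) • (a * a) + (3 : ℝ) • (a * b) + b * b + c * b
      - (a + (2⁻¹ : ℝ) • b) := by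
    rw [peirceOne_apply, mul_comm q p, hpq]
    conv_lhs => rw [hqabc]
    simp only [add_mul, mul_add, mul_smul_comm, mul_comm c a, mul_comm b a, hac]
    module
  have hEa : peirceOne p a = a := by
    rw [peirceOne_of_mul_eq (c := 1) (by rw [hpa, one_smul])]; module
  have hEb : peirceOne p b = 0 := by
    rw [peirceOne_of_mul_eq hpb]; module
  rw [hqp, ← ha]
  rw [← ha] at hqq
  simp only [map_add, map_sub, map_smul, haa, hab, hcb, hEa, hEb]
  conv_lhs => rw [show peirceOne p (b * b) = a - a * a by rw [eq_sub_iff_add_eq']; exact hqq.symm]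
  module

end Peirce

/-! ### The trace form, the unit and positivity -/

section Trace

/-- The linear form `x ↦ Tr L(x)`. -/
noncomputable def mulTrace : J →ₗ[ℝ] ℝ := LinearMap.trace ℝ J ∘ₗ LinearMap.mul ℝ J

theorem mulTrace_apply (x : J) : mulTrace x = LinearMap.trace ℝ J (mulOp x) := rfl

theorem mulTrace_assoc (x y z : J) : mulTrace ((x * y) * z) = mulTrace (x * (y * z)) := by
  rw [← sub_eq_zero, mulTrace_apply, mulTrace_apply, ← map_sub, mulOp_associator, map_sub,
    LinearMap.trace_mul_comm, sub_self]

theorem mulTrace_mul_right_comm (x y z : J) :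
    mulTrace ((x * y) * z) = mulTrace (y * (x * z)) := by
  rw [mul_comm x y, mulTrace_assoc]

theorem mulTrace_peirceOne_mul (p y z : J) :
    mulTrace (peirceOne p y * z) = mulTrace (y * peirceOne p z) := by
  simp only [peirceOne_apply, sub_mul, mul_sub, map_sub, smul_mul_assoc, mul_smul_comm, map_smul,
    mulTrace_mul_right_comm]

theorem mulTrace_peirceHalf_mul (p y z : J) :
    mulTrace (peirceHalf p y * z) = mulTrace (y * peirceHalf p z) := by
  simp only [peirceHalf_apply, sub_mul, mul_sub, map_sub, smul_mul_assoc, mul_smul_comm, map_smul,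
    mulTrace_mul_right_comm]

theorem mulTrace_peirceOne_idempotent {p : J} (hp : p * p = p) (q : J) :
    mulTrace (peirceOne p q) = mulTrace (p * q) := by
  rw [peirceOne_apply, map_sub, map_smul, ← mulTrace_assoc, hp, smul_eq_mul]; ring

variable [FiniteDimensional ℝ J]

/-- `Tr L(p) = dim J₁(p) + ½ dim J_{1/2}(p)`, and `J₁(p)` contains `p`. -/
theorem one_le_mulTrace_idempotent {p : J} (hp : p * p = p) (hp0 : p ≠ 0) : 1 ≤ mulTrace p := by
  have hL : mulOp p = peirceOne p + (2⁻¹ : ℝ) • peirceHalf p :=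
    LinearMap.ext fun y => mul_eq_peirce y
  have h1 : IsIdempotentElem (peirceOne p) := LinearMap.ext fun y => peirceOne_idem hp y
  have h2 : IsIdempotentElem (peirceHalf p) := LinearMap.ext fun y => peirceHalf_idem hp y
  rw [mulTrace_apply, hL, map_add, map_smul,
    (LinearMap.IsIdempotentElem.isProj_range _ h1).trace,
    (LinearMap.IsIdempotentElem.isProj_range _ h2).trace]
  have hpos : 0 < Module.finrank ℝ (LinearMap.range (peirceOne p)) := by
    have : Nontrivial (LinearMap.range (peirceOne p)) := by
      refine ⟨⟨⟨p, p, ?_⟩, 0, ?_⟩⟩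
      · rw [peirceOne_of_mul_eq (c := 1) (by rw [hp, one_smul])]; module
      · intro h; exact hp0 (congrArg Subtype.val h)
    exact Module.finrank_pos
  have h3 : (1 : ℝ) ≤ Module.finrank ℝ (LinearMap.range (peirceOne p)) := by exact_mod_cast hpos
  have h4 : (0 : ℝ) ≤ (2⁻¹ : ℝ) • (Module.finrank ℝ (LinearMap.range (peirceHalf p)) : ℝ) := by
    rw [smul_eq_mul]; positivity
  linarith

variable (J) in
/-- Formal reality of an algebra. -/
def FormallyReal : Prop := ∀ a b : J, a * a + b * b = 0 → a = 0 ∧ b = 0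

variable (hreal : FormallyReal J)
include hreal

/-- Along orthogonal idempotents `x² = ∑ a² q_a`, and each nonzero `q_a` has positive trace. -/
theorem mulTrace_mul_self_pos {x : J} (hx : x ≠ 0) : 0 < mulTrace (x * x) := by
  obtain ⟨s, q, hidem, horth, hsum, -⟩ := exists_orthogonal_idempotents hreal x
  have hxx : x * x = ∑ a ∈ s, (a * a) • q a := by
    conv_lhs => rw [hsum]
    rw [Finset.sum_mul]
    refine Finset.sum_congr rfl fun a ha => ?_
    rw [Finset.mul_sum, Finset.sum_eq_single_of_mem a ha, smul_mul_smul_comm, hidem a ha]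
    intro b hb hba
    rw [smul_mul_smul_comm, horth a ha b hb hba.symm, smul_zero]
  have hterm : ∀ a ∈ s, 0 ≤ (a * a) * mulTrace (q a) := fun a ha => by
    by_cases h0 : q a = 0
    · simp [h0]
    · have := one_le_mulTrace_idempotent (hidem a ha) h0
      exact mul_nonneg (mul_self_nonneg a) (by linarith)
  have hval : mulTrace (x * x) = ∑ a ∈ s, (a * a) * mulTrace (q a) := by
    rw [hxx, map_sum]; simp only [map_smul, smul_eq_mul]
  rw [hval]
  refine lt_of_le_of_ne (Finset.sum_nonneg hterm) fun h => hx ?_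
  rw [eq_comm, Finset.sum_eq_zero_iff_of_nonneg hterm] at h
  rw [hsum]
  refine Finset.sum_eq_zero fun a ha => ?_
  rcases mul_eq_zero.mp (h a ha) with h1 | h1
  · rw [mul_self_eq_zero.mp h1, zero_smul]
  · by_cases h0 : q a = 0
    · rw [h0, smul_zero]
    · have := one_le_mulTrace_idempotent (hidem a ha) h0
      linarith

theorem mulTrace_mul_self_nonneg (x : J) : 0 ≤ mulTrace (x * x) := by
  by_cases hx : x = 0
  · simp [hx]
  · exact (mulTrace_mul_self_pos hreal hx).le

theorem eq_zero_of_mulTrace_mul_self {x : J} (h : mulTrace (x * x) = 0) : x = 0 := by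
  by_contra hx
  exact (mulTrace_mul_self_pos hreal hx).ne' h

/-- A formally real Jordan algebra has a unit. -/
theorem exists_unit : ∃ e : J, ∀ y, e * y = y := by
  let B : J →ₗ[ℝ] Module.Dual ℝ J := (LinearMap.mul ℝ J).compr₂ mulTrace
  have hB : ∀ x y, B x y = mulTrace (x * y) := fun _ _ => rfl
  have hinj : Function.Injective B := by
    rw [injective_iff_map_eq_zero]
    intro x hx
    exact eq_zero_of_mulTrace_mul_self hreal (by rw [← hB, hx, LinearMap.zero_apply])
  -- The unit represents `τ` itself: `τ((e y) z) = τ(e (y z)) = τ(y z)` for all `z`.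
  obtain ⟨e, he⟩ := (LinearMap.injective_iff_surjective_of_finrank_eq_finrank
    (Subspace.dual_finrank_eq (K := ℝ) (V := J)).symm).mp hinj mulTrace
  refine ⟨e, fun y => hinj (LinearMap.ext fun z => ?_)⟩
  rw [hB, hB, mulTrace_assoc, ← hB, he]

/-- Multiplication by an idempotent is a positive operator for the trace form. -/
theorem mulTrace_idempotent_mul_mul_nonneg {p : J} (hp : p * p = p) (y : J) :
    0 ≤ mulTrace ((p * y) * y) ∧ (mulTrace ((p * y) * y) = 0 → p * y = 0) := by
  have h : mulTrace ((p * y) * y) = mulTrace (peirceOne p y * peirceOne p y)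
      + 2⁻¹ * mulTrace (peirceHalf p y * peirceHalf p y) := by
    rw [mul_eq_peirce (p := p) y, add_mul, map_add, smul_mul_assoc, map_smul, smul_eq_mul]
    congr 1
    · rw [← mulTrace_peirceOne_mul, peirceOne_idem hp]
    · rw [← mulTrace_peirceHalf_mul, peirceHalf_idem hp]
  have h1 := mulTrace_mul_self_nonneg hreal (peirceOne p y)
  have h2 := mulTrace_mul_self_nonneg hreal (peirceHalf p y)
  refine ⟨by rw [h]; positivity, fun h0 => ?_⟩
  rw [h] at h0
  have h3 := eq_zero_of_mulTrace_mul_self hreal (x := peirceOne p y) (by linarith)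
  have h4 := eq_zero_of_mulTrace_mul_self hreal (x := peirceHalf p y) (by linarith)
  rw [mul_eq_peirce, h3, h4, smul_zero, add_zero]

theorem mulTrace_idempotent_mul_nonneg {p q : J} (hp : p * p = p) (hq : q * q = q) :
    0 ≤ mulTrace (p * q) ∧ (mulTrace (p * q) = 0 → p * q = 0) := by
  have h : mulTrace (p * q) = mulTrace ((p * q) * q) := by
    rw [mulTrace_assoc, hq]
  rw [h]
  exact mulTrace_idempotent_mul_mul_nonneg hreal hp q

/-- Idempotents whose sum is an idempotent are orthogonal. -/
theorem orthogonal_of_sum_idempotent {ι : Type*} [Fintype ι] {q : ι → J}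
    (hq : ∀ i, q i * q i = q i) (hsum : (∑ i, q i) * (∑ i, q i) = ∑ i, q i) {i j : ι}
    (hij : i ≠ j) : q i * q j = 0 := by
  classical
  have hnn : ∀ i j, 0 ≤ mulTrace (q i * q j) := fun i j =>
    (mulTrace_idempotent_mul_nonneg hreal (hq i) (hq j)).1
  have h := congrArg mulTrace hsum
  -- Taking `τ` of `(∑ q)² = ∑ q` leaves a vanishing sum of the nonnegative off-diagonal terms
  -- `τ(q_k q_l)`.
  rw [Finset.sum_mul_sum, map_sum, map_sum, ← sub_eq_zero, ← Finset.sum_sub_distrib] at h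
  have hterm : ∀ k, mulTrace (∑ l, q k * q l) - mulTrace (q k)
      = ∑ l ∈ Finset.univ.erase k, mulTrace (q k * q l) := fun k => by
    rw [map_sum, ← Finset.add_sum_erase _ _ (Finset.mem_univ k), hq, add_sub_cancel_left]
  simp only [hterm] at h
  rw [Finset.sum_eq_zero_iff_of_nonneg
    (fun k _ => Finset.sum_nonneg fun l _ => hnn k l)] at h
  have h' := h i (Finset.mem_univ i)
  rw [Finset.sum_eq_zero_iff_of_nonneg (fun l _ => hnn i l)] at h'
  exact (mulTrace_idempotent_mul_nonneg hreal (hq i) (hq j)).2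
    (h' j (Finset.mem_erase.mpr ⟨hij.symm, Finset.mem_univ j⟩))

/-- The Peirce space `{y | p y = y}` of a primitive idempotent is a line. -/
theorem eq_smul_of_primitive_mul_eq {p : J} (hp : IsPrimitiveIdempotent p) {x : J}
    (hx : p * x = x) : ∃ c : ℝ, x = c • p := by
  obtain ⟨s, q, hidem, -, hsum, hmem⟩ := exists_orthogonal_idempotents hreal x
  -- The `1`-space is a subalgebra, so it contains the spectral idempotents `q_a` of `x`; the
  -- splitting `p = q_a + (p - q_a)` then forces `q_a = 0` or `q_a = p`.
  let S : Submodule ℝ J :=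
    { carrier := {y | p * y = y}
      add_mem' := fun {a b} ha hb => by
        change p * (a + b) = a + b
        rw [mul_add, show p * a = a from ha, show p * b = b from hb]
      zero_mem' := mul_zero p
      smul_mem' := fun c a ha => by
        change p * (c • a) = c • a
        rw [mul_smul_comm, show p * a = a from ha] }
  have hS : ∀ a ∈ S, ∀ b ∈ S, a * b ∈ S := fun a ha b hb => by
    change p * (a * b) = a * b
    rw [idempotent_mul_mul_comm hp.1 (Or.inl ha), show p * b = b from hb]
  have hline : ∀ a ∈ s, ∃ c : ℝ, q a = c • p := fun a ha => by
    have hpq : p * q a = q a := hmem S hx hS a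
    have hqp : q a * p = q a := by rw [mul_comm, hpq]
    rcases hp.2.2 (q a) (p - q a) (hidem a ha)
      (by rw [mul_sub, sub_mul, sub_mul, hp.1, hpq, hqp, hidem a ha]; abel)
      (by rw [mul_sub, hqp, hidem a ha, sub_self]) (by abel) with h | h
    · exact ⟨0, by rw [h, zero_smul]⟩
    · exact ⟨1, by rw [one_smul]; exact (sub_eq_zero.mp h).symm⟩
  choose! c hc using hline
  refine ⟨∑ a ∈ s, a * c a, ?_⟩
  rw [Finset.sum_smul]
  conv_lhs => rw [hsum]
  exact Finset.sum_congr rfl fun a ha => by rw [mul_smul, ← hc a ha]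

/-- Primitive idempotents that are not orthogonal have the same trace. -/
theorem mulTrace_eq_of_primitive {p q : J} (hp : IsPrimitiveIdempotent p)
    (hq : IsPrimitiveIdempotent q) (hpq : mulTrace (p * q) ≠ 0) : mulTrace p = mulTrace q := by
  obtain ⟨c, hc⟩ := eq_smul_of_primitive_mul_eq hreal hp (mul_peirceOne hp.1 q)
  obtain ⟨d, hd⟩ := eq_smul_of_primitive_mul_eq hreal hq (mul_peirceOne hq.1 p)
  -- With `P(p) q = c p` and `P(q) p = d q`, the quadratic identity gives `d c = c²`, while traces
  -- give `c τ(p) = τ(pq) = d τ(q)`.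
  have h := peirceOne_peirceOne_idempotent hp.1 hq.1
  rw [hd, map_smul, hc, smul_mul_smul_comm, hp.1, smul_smul] at h
  have hdc : d * c = c * c := by
    rw [← sub_eq_zero, ← sub_smul, smul_eq_zero] at h
    exact sub_eq_zero.mp (h.resolve_right hp.2.1)
  have h1 := mulTrace_peirceOne_idempotent hp.1 q
  have h2 := mulTrace_peirceOne_idempotent hq.1 p
  rw [hc, map_smul, smul_eq_mul] at h1
  rw [hd, map_smul, smul_eq_mul, mul_comm q p] at h2
  have hc0 : c ≠ 0 := by rintro rfl; rw [zero_mul] at h1; exact hpq h1.symm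
  have hdc' : d = c := mul_right_cancel₀ hc0 hdc
  rw [hdc', ← h1] at h2
  exact (mul_left_cancel₀ hc0 h2).symm

/-! ### Spectral theorem and linearity of the trace -/

/-- Every idempotent is a sum of primitive idempotents. -/
theorem exists_sum_primitive {p : J} (hp : p * p = p) :
    ∃ (n : ℕ) (r : Fin n → J), (∀ i, IsPrimitiveIdempotent (r i)) ∧ p = ∑ i, r i := by
  -- Induction on a bound for `τ(p)`: in a proper splitting each summand has trace at least `1`, so
  -- the bound drops by `1`.
  obtain ⟨N, hN⟩ := exists_nat_ge (mulTrace p)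
  induction N generalizing p with
  | zero =>
    refine ⟨0, Fin.elim0, fun i => i.elim0, ?_⟩
    by_contra h0
    have := one_le_mulTrace_idempotent hp (by simpa using h0)
    norm_num at hN
    linarith
  | succ N ih =>
    by_cases h0 : p = 0
    · exact ⟨0, Fin.elim0, fun i => i.elim0, by simpa using h0⟩
    by_cases hprim : IsPrimitiveIdempotent p
    · exact ⟨1, fun _ => p, fun _ => hprim, by simp⟩
    have : ∃ a b : J, a * a = a ∧ b * b = b ∧ p = a + b ∧ a ≠ 0 ∧ b ≠ 0 := by
      by_contra hcon
      push Not at hcon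
      refine hprim ⟨hp, h0, fun a b ha hb _ hab => ?_⟩
      by_cases ha0 : a = 0
      · exact Or.inl ha0
      · exact Or.inr (hcon a b ha hb hab ha0)
    obtain ⟨a, b, ha, hb, hab, ha0, hb0⟩ := this
    have h1 := one_le_mulTrace_idempotent ha ha0
    have h2 := one_le_mulTrace_idempotent hb hb0
    rw [hab, map_add] at hN
    push_cast at hN
    obtain ⟨m, r, hr, hra⟩ := ih ha (by linarith)
    obtain ⟨n, t, ht, htb⟩ := ih hb (by linarith)
    refine ⟨m + n, Fin.append r t, fun i => ?_, ?_⟩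
    · induction i using Fin.addCases with
      | left i => rw [Fin.append_left]; exact hr i
      | right i => rw [Fin.append_right]; exact ht i
    · rw [Fin.sum_univ_add]
      simp only [Fin.append_left, Fin.append_right]
      rw [← hra, ← htb, hab]

/-- The spectral theorem. -/
theorem nonempty_spectralDecomposition (x : J) : Nonempty (SpectralDecomposition x) := by
  obtain ⟨e, he⟩ := exists_unit hreal
  obtain ⟨s, q, hidem, horth, hsum, -⟩ := exists_orthogonal_idempotents hreal x
  have hcc : (∑ a ∈ s, q a) * (∑ a ∈ s, q a) = ∑ a ∈ s, q a := by
    rw [Finset.sum_mul]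
    refine Finset.sum_congr rfl fun a ha => ?_
    rw [Finset.mul_sum, Finset.sum_eq_single_of_mem a ha, hidem a ha]
    exact fun b hb hba => horth a ha b hb hba.symm
  have hcomp : (e - ∑ a ∈ s, q a) * (e - ∑ a ∈ s, q a) = e - ∑ a ∈ s, q a := by
    rw [sub_mul, mul_sub, mul_sub, he, he, mul_comm _ e, he, hcc]; abel
  -- The index `none` carries the complementary idempotent, with eigenvalue `0`, so that the sum is
  -- the unit.
  let g : Option s → J := fun o => o.elim (e - ∑ a ∈ s, q a) fun a => q a
  let c : Option s → ℝ := fun o => o.elim 0 fun a => a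
  have hg : ∀ o, g o * g o = g o := by
    rintro (_ | ⟨a, ha⟩)
    · exact hcomp
    · exact hidem a ha
  choose n r hr hgr using fun o => exists_sum_primitive hreal (hg o)
  have hgsum : ∑ o, g o = e := by
    rw [Fintype.sum_option]
    change e - ∑ a ∈ s, q a + ∑ a : s, q a = e
    rw [Finset.sum_coe_sort s q, sub_add_cancel]
  have hxsum : ∑ o, c o • g o = x := by
    rw [Fintype.sum_option]
    change (0 : ℝ) • (e - ∑ a ∈ s, q a) + ∑ a : s, (a : ℝ) • q a = x
    rw [Finset.sum_coe_sort s fun a => a • q a, zero_smul, zero_add, ← hsum]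
  let φ := Fintype.equivFin (Σ o, Fin (n o))
  have htot : ∑ i, r (φ.symm i).1 (φ.symm i).2 = e := by
    rw [φ.symm.sum_comp fun z : (Σ o, Fin (n o)) => r z.1 z.2, Fintype.sum_sigma, ← hgsum]
    exact Finset.sum_congr rfl fun o _ => (hgr o).symm
  refine ⟨⟨_, fun i => r (φ.symm i).1 (φ.symm i).2, fun i => c (φ.symm i).1,
    ⟨fun i => hr _ _, fun i j hij => ?_, fun y => ?_⟩, ?_⟩⟩
  · exact orthogonal_of_sum_idempotent hreal (fun i => (hr (φ.symm i).1 (φ.symm i).2).1)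
      (by rw [htot, he]) hij
  · rw [htot, he]
  · rw [φ.symm.sum_comp fun z : (Σ o, Fin (n o)) => c z.1 • r z.1 z.2, Fintype.sum_sigma,
      ← hxsum]
    refine Finset.sum_congr rfl fun o _ => ?_
    rw [hgr o, Finset.smul_sum]

/-- There is a linear form taking the value `1` at every primitive idempotent. -/
theorem exists_linear_trace :
    ∃ T : J →ₗ[ℝ] ℝ, ∀ p : J, IsPrimitiveIdempotent p → T p = 1 := by
  obtain ⟨d⟩ := nonempty_spectralDecomposition hreal (0 : J)
  obtain ⟨hprim, -, hunit⟩ := d.isJordanFrame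
  -- `T y = ∑ τ(p_i y) / τ(p_i)` for one fixed frame. At a primitive `q`, every nonzero term has
  -- `τ(p_i) = τ(q)`, so the sum is `τ(q) / τ(q)`.
  refine ⟨mulTrace ∘ₗ LinearMap.mulLeft ℝ (∑ i, (mulTrace (d.frame i))⁻¹ • d.frame i),
    fun q hq => ?_⟩
  have hq1 := one_le_mulTrace_idempotent hq.1 hq.2.1
  have hterm : ∀ i, (mulTrace (d.frame i))⁻¹ * mulTrace (d.frame i * q)
      = (mulTrace q)⁻¹ * mulTrace (d.frame i * q) := fun i => by
    by_cases h : mulTrace (d.frame i * q) = 0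
    · rw [h, mul_zero, mul_zero]
    · rw [mulTrace_eq_of_primitive hreal (hprim i) hq h]
  simp only [LinearMap.comp_apply, LinearMap.mulLeft_apply, Finset.sum_mul, map_sum,
    smul_mul_assoc, map_smul, smul_eq_mul, hterm]
  rw [← Finset.mul_sum, ← map_sum, ← Finset.sum_mul, hunit]
  exact inv_mul_cancel₀ (by linarith)

theorem exists_trace_eq_linear :
    ∃ T : J →ₗ[ℝ] ℝ, (∀ x, trace x = T x) ∧ ∀ p : J, IsPrimitiveIdempotent p → T p = 1 := by
  obtain ⟨T, hT⟩ := exists_linear_trace hreal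
  refine ⟨T, fun x => ?_, hT⟩
  have h := nonempty_spectralDecomposition hreal x
  rw [trace, dif_pos h]
  conv_rhs => rw [h.some.eq_sum]
  simp [hT _ (h.some.isJordanFrame.1 _)]

end Trace

end Jordan

/-! ### The largest eigenvalue and the two norms -/

section Order

variable {J : Type*} [NonUnitalNonAssocCommRing J] [Module ℝ J]
  [IsScalarTower ℝ J J] [SMulCommClass ℝ J J] [IsCommJordan J] [FiniteDimensional ℝ J]

/-- The decomposition along a given frame. -/
def SpectralDecomposition.ofFrame {r : ℕ} {p : Fin r → J} (hp : IsJordanFrame p) (a : Fin r → ℝ) :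
    SpectralDecomposition (∑ i, a i • p i) :=
  ⟨r, p, a, hp, rfl⟩

theorem SpectralDecomposition.mul_frame {x : J} (d : SpectralDecomposition x) (i : Fin d.rank) :
    x * d.frame i = d.eigenvalue i • d.frame i := by
  rw [congrArg (· * d.frame i) d.eq_sum]
  simp only [Finset.sum_mul]
  rw [Finset.sum_eq_single_of_mem i (Finset.mem_univ i), smul_mul_assoc,
    (d.isJordanFrame.1 i).1]
  intro j _ hji
  rw [smul_mul_assoc, d.isJordanFrame.2.1 j i hji, smul_zero]

theorem spec_neg_mem {x : J} {μ : ℝ} (h : μ ∈ spec x) : -μ ∈ spec (-x) := by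
  obtain ⟨d, i, rfl⟩ := h
  refine ⟨⟨d.rank, d.frame, fun i => -d.eigenvalue i, d.isJordanFrame, ?_⟩, i, rfl⟩
  conv_lhs => rw [d.eq_sum]
  simp

/-- The largest eigenvalue. -/
noncomputable def maxEigenvalue (x : J) : ℝ := sSup (spec x)

variable (hreal : FormallyReal J)
include hreal

/-- `τ((x y) y)` is the combination of the eigenvalues with the nonnegative weights `τ((p_i y) y)`,
whose sum is `τ(y y)`. -/
theorem mulTrace_mul_mul_le_of_decomposition {x : J} (d : SpectralDecomposition x) {c : ℝ}
    (h : ∀ i, d.eigenvalue i ≤ c) (y : J) : mulTrace ((x * y) * y) ≤ c * mulTrace (y * y) := by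
  have h1 : mulTrace ((x * y) * y)
      = ∑ i, d.eigenvalue i * mulTrace ((d.frame i * y) * y) := by
    conv_lhs => rw [d.eq_sum]
    simp only [Finset.sum_mul, map_sum, smul_mul_assoc, map_smul, smul_eq_mul]
  have h2 : mulTrace (y * y) = ∑ i, mulTrace ((d.frame i * y) * y) := by
    rw [← map_sum, ← Finset.sum_mul, ← Finset.sum_mul, d.isJordanFrame.2.2]
  rw [h1, h2, Finset.mul_sum]
  exact Finset.sum_le_sum fun i _ => mul_le_mul_of_nonneg_right (h i)
    (mulTrace_idempotent_mul_mul_nonneg hreal (d.isJordanFrame.1 i).1 y).1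

/-- Tested at `y = p_i`, the bound on the form becomes a bound on the eigenvalue, in whichever
decomposition it occurs. -/
theorem le_of_mem_spec {x : J} {c μ : ℝ}
    (h : ∀ y, mulTrace ((x * y) * y) ≤ c * mulTrace (y * y)) (hμ : μ ∈ spec x) : μ ≤ c := by
  obtain ⟨d, i, rfl⟩ := hμ
  have h1 := h (d.frame i)
  rw [d.mul_frame, smul_mul_assoc, map_smul, smul_eq_mul] at h1
  exact le_of_mul_le_mul_right h1
    (mulTrace_mul_self_pos hreal (d.isJordanFrame.1 i).2.1)

variable [Nontrivial J]

theorem SpectralDecomposition.rank_pos {x : J} (d : SpectralDecomposition x) : 0 < d.rank := by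
  obtain ⟨y, hy⟩ := exists_ne (0 : J)
  by_contra h
  have h0 : IsEmpty (Fin d.rank) := ⟨fun i => h i.pos⟩
  have := d.isJordanFrame.2.2 y
  rw [Finset.univ_eq_empty, Finset.sum_empty, zero_mul] at this
  exact hy this.symm

theorem isGreatest_maxEigenvalue (x : J) : IsGreatest (spec x) (maxEigenvalue x) := by
  obtain ⟨d⟩ := nonempty_spectralDecomposition hreal x
  have : Nonempty (Fin d.rank) := ⟨⟨0, d.rank_pos hreal⟩⟩
  obtain ⟨i, hi⟩ := Finite.exists_max d.eigenvalue
  have h : IsGreatest (spec x) (d.eigenvalue i) :=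
    ⟨⟨d, i, rfl⟩, fun μ hμ => le_of_mem_spec hreal
      (mulTrace_mul_mul_le_of_decomposition hreal d hi) hμ⟩
  rw [maxEigenvalue, h.csSup_eq]
  exact h

theorem maxEigenvalue_le_iff {x : J} {c : ℝ} :
    maxEigenvalue x ≤ c ↔ ∀ y, mulTrace ((x * y) * y) ≤ c * mulTrace (y * y) := by
  refine ⟨fun h => ?_, fun h => le_of_mem_spec hreal h (isGreatest_maxEigenvalue hreal x).1⟩
  obtain ⟨d⟩ := nonempty_spectralDecomposition hreal x
  exact mulTrace_mul_mul_le_of_decomposition hreal d fun i =>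
    ((isGreatest_maxEigenvalue hreal x).2 ⟨d, i, rfl⟩).trans h

theorem maxEigenvalue_sum_le {r : ℕ} {p : Fin r → J} (hp : IsJordanFrame p) {a : Fin r → ℝ}
    {c : ℝ} (h : ∀ i, a i ≤ c) : maxEigenvalue (∑ i, a i • p i) ≤ c :=
  (maxEigenvalue_le_iff hreal).mpr
    (mulTrace_mul_mul_le_of_decomposition hreal (SpectralDecomposition.ofFrame hp a) h)

theorem maxEigenvalue_add_le (x y : J) :
    maxEigenvalue (x + y) ≤ maxEigenvalue x + maxEigenvalue y := by
  rw [maxEigenvalue_le_iff hreal]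
  intro z
  rw [add_mul, add_mul, map_add, add_mul]
  exact add_le_add ((maxEigenvalue_le_iff hreal).mp le_rfl z)
    ((maxEigenvalue_le_iff hreal).mp le_rfl z)

theorem maxEigenvalue_smul_le {c : ℝ} (hc : 0 ≤ c) (x : J) :
    maxEigenvalue (c • x) ≤ c * maxEigenvalue x := by
  rw [maxEigenvalue_le_iff hreal]
  intro z
  rw [smul_mul_assoc, smul_mul_assoc, map_smul, smul_eq_mul, mul_assoc]
  exact mul_le_mul_of_nonneg_left ((maxEigenvalue_le_iff hreal).mp le_rfl z) hc

theorem maxEigenvalue_smul {c : ℝ} (hc : 0 < c) (x : J) :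
    maxEigenvalue (c • x) = c * maxEigenvalue x := by
  refine le_antisymm (maxEigenvalue_smul_le hreal hc.le x) ?_
  have h := maxEigenvalue_smul_le hreal (inv_nonneg.mpr hc.le) (c • x)
  rw [inv_smul_smul₀ hc.ne'] at h
  calc c * maxEigenvalue x ≤ c * (c⁻¹ * maxEigenvalue (c • x)) :=
        mul_le_mul_of_nonneg_left h hc.le
    _ = maxEigenvalue (c • x) := mul_inv_cancel_left₀ hc.ne' _

theorem maxEigenvalue_zero : maxEigenvalue (0 : J) = 0 := by
  have h := maxEigenvalue_smul hreal (c := 2) two_pos (0 : J)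
  rw [smul_zero] at h
  linarith

theorem maxEigenvalue_smul_unit {e : J} (he : ∀ y, e * y = y) (c : ℝ) :
    maxEigenvalue (c • e) = c := by
  refine le_antisymm ((maxEigenvalue_le_iff hreal).mpr fun y => ?_) ?_
  · rw [smul_mul_assoc, he, smul_mul_assoc, map_smul, smul_eq_mul]
  · obtain ⟨y, hy⟩ := exists_ne (0 : J)
    have h := (maxEigenvalue_le_iff hreal).mp (le_refl (maxEigenvalue (c • e))) y
    rw [smul_mul_assoc, he, smul_mul_assoc, map_smul, smul_eq_mul] at h
    exact le_of_mul_le_mul_right h (mulTrace_mul_self_pos hreal hy)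

theorem neg_maxEigenvalue_neg_mem (x : J) : -maxEigenvalue (-x) ∈ spec x := by
  have := spec_neg_mem (isGreatest_maxEigenvalue hreal (-x)).1
  rwa [neg_neg] at this

theorem neg_maxEigenvalue_neg_le {x : J} {μ : ℝ} (hμ : μ ∈ spec x) :
    -maxEigenvalue (-x) ≤ μ := by
  have := (isGreatest_maxEigenvalue hreal (-x)).2 (spec_neg_mem hμ)
  linarith

theorem neg_maxEigenvalue_neg_le_maxEigenvalue (x : J) :
    -maxEigenvalue (-x) ≤ maxEigenvalue x :=
  neg_maxEigenvalue_neg_le hreal (isGreatest_maxEigenvalue hreal x).1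

theorem specNorm_eq (x : J) : specNorm x = max (maxEigenvalue x) (maxEigenvalue (-x)) := by
  refine IsGreatest.csSup_eq ⟨?_, ?_⟩
  · have h0 := neg_maxEigenvalue_neg_le_maxEigenvalue hreal x
    rcases le_total (maxEigenvalue (-x)) (maxEigenvalue x) with h | h
    · refine ⟨_, (isGreatest_maxEigenvalue hreal x).1, ?_⟩
      rw [max_eq_left h, abs_of_nonneg (by linarith)]
    · refine ⟨_, neg_maxEigenvalue_neg_mem hreal x, ?_⟩
      rw [max_eq_right h, abs_neg, abs_of_nonneg (by linarith)]
  · rintro _ ⟨μ, hμ, rfl⟩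
    rw [abs_le']
    refine ⟨((isGreatest_maxEigenvalue hreal x).2 hμ).trans (le_max_left _ _), ?_⟩
    exact ((isGreatest_maxEigenvalue hreal (-x)).2 (spec_neg_mem hμ)).trans (le_max_right _ _)

theorem specDiam_eq (x : J) : specDiam x = maxEigenvalue x + maxEigenvalue (-x) := by
  have h0 := neg_maxEigenvalue_neg_le_maxEigenvalue hreal x
  refine IsGreatest.csSup_eq ⟨?_, ?_⟩
  · refine ⟨_, (isGreatest_maxEigenvalue hreal x).1, _, neg_maxEigenvalue_neg_mem hreal x, ?_⟩
    rw [sub_neg_eq_add, abs_of_nonneg (by linarith)]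
  · rintro _ ⟨μ, hμ, ν, hν, rfl⟩
    have h1 := (isGreatest_maxEigenvalue hreal x).2 hμ
    have h2 := (isGreatest_maxEigenvalue hreal x).2 hν
    have h3 := neg_maxEigenvalue_neg_le hreal hμ
    have h4 := neg_maxEigenvalue_neg_le hreal hν
    rw [abs_le']
    constructor <;> linarith

theorem abs_le_specNorm {x : J} {μ : ℝ} (hμ : μ ∈ spec x) : |μ| ≤ specNorm x := by
  rw [specNorm_eq hreal, abs_le']
  exact ⟨((isGreatest_maxEigenvalue hreal x).2 hμ).trans (le_max_left _ _),
    ((isGreatest_maxEigenvalue hreal (-x)).2 (spec_neg_mem hμ)).trans (le_max_right _ _)⟩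

theorem specNorm_neg (x : J) : specNorm (-x) = specNorm x := by
  rw [specNorm_eq hreal, specNorm_eq hreal, neg_neg, max_comm]

theorem specNorm_add_le (x y : J) : specNorm (x + y) ≤ specNorm x + specNorm y := by
  simp only [specNorm_eq hreal]
  refine max_le ((maxEigenvalue_add_le hreal x y).trans
    (add_le_add (le_max_left _ _) (le_max_left _ _))) ?_
  rw [neg_add]
  exact (maxEigenvalue_add_le hreal _ _).trans
    (add_le_add (le_max_right _ _) (le_max_right _ _))

theorem specNorm_smul (c : ℝ) (x : J) : specNorm (c • x) = |c| * specNorm x := by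
  simp only [specNorm_eq hreal]
  rcases lt_trichotomy c 0 with hc | rfl | hc
  · rw [show c • x = (-c) • (-x) by module, show -((-c) • (-x)) = (-c) • x by module,
      maxEigenvalue_smul hreal (neg_pos.mpr hc), maxEigenvalue_smul hreal (neg_pos.mpr hc),
      abs_of_neg hc, max_comm, mul_max_of_nonneg _ _ (neg_pos.mpr hc).le]
  · simp [maxEigenvalue_zero hreal]
  · rw [← smul_neg, maxEigenvalue_smul hreal hc, maxEigenvalue_smul hreal hc, abs_of_pos hc,
      mul_max_of_nonneg _ _ hc.le]

theorem specDiam_add_le (x y : J) : specDiam (x + y) ≤ specDiam x + specDiam y := by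
  simp only [specDiam_eq hreal]
  have h1 := maxEigenvalue_add_le hreal x y
  have h2 := maxEigenvalue_add_le hreal (-x) (-y)
  rw [← neg_add] at h2
  linarith

theorem specDiam_smul (c : ℝ) (x : J) : specDiam (c • x) = |c| * specDiam x := by
  simp only [specDiam_eq hreal]
  rcases lt_trichotomy c 0 with hc | rfl | hc
  · rw [show c • x = (-c) • (-x) by module, show -((-c) • (-x)) = (-c) • x by module,
      maxEigenvalue_smul hreal (neg_pos.mpr hc), maxEigenvalue_smul hreal (neg_pos.mpr hc),
      abs_of_neg hc]
    ring
  · simp [maxEigenvalue_zero hreal]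
  · rw [← smul_neg, maxEigenvalue_smul hreal hc, maxEigenvalue_smul hreal hc, abs_of_pos hc]
    ring

theorem eq_zero_of_specNorm_eq_zero {x : J} (h : specNorm x = 0) : x = 0 := by
  obtain ⟨d⟩ := nonempty_spectralDecomposition hreal x
  rw [d.eq_sum]
  refine Finset.sum_eq_zero fun i _ => ?_
  have h1 := abs_le_specNorm hreal (⟨d, i, rfl⟩ : d.eigenvalue i ∈ spec x)
  rw [h] at h1
  rw [abs_nonpos_iff.mp h1, zero_smul]

theorem isNorm_specNorm : IsNorm (fun u : J => specNorm u) :=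
  ⟨Seminorm.of specNorm (specNorm_add_le hreal) (fun c x => specNorm_smul hreal c x),
    fun _ => rfl, fun _ h => eq_zero_of_specNorm_eq_zero hreal h⟩

/-- Zero diameter makes `x` a multiple `λ e` of the unit, whose trace is `rank * λ`. -/
theorem eq_zero_of_specDiam_eq_zero {T : J →ₗ[ℝ] ℝ}
    (hT : ∀ p : J, IsPrimitiveIdempotent p → T p = 1) {x : J} (hx : T x = 0)
    (h : specDiam x = 0) : x = 0 := by
  obtain ⟨d⟩ := nonempty_spectralDecomposition hreal x
  have hc : ∀ i, d.eigenvalue i = maxEigenvalue x := fun i => by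
    have hi : d.eigenvalue i ∈ spec x := ⟨d, i, rfl⟩
    have h1 := (isGreatest_maxEigenvalue hreal x).2 hi
    have h2 := neg_maxEigenvalue_neg_le hreal hi
    rw [specDiam_eq hreal] at h
    linarith
  have hsum := d.eq_sum
  simp only [hc] at hsum
  have h1 : T x = d.rank * maxEigenvalue x := by
    rw [congrArg T hsum]; simp [hT _ (d.isJordanFrame.1 _)]
  have hr : (d.rank : ℝ) ≠ 0 := by exact_mod_cast (d.rank_pos hreal).ne'
  rw [hx, eq_comm, mul_eq_zero] at h1
  rw [hsum, h1.resolve_left hr]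
  simp

theorem isNorm_specDiam {T : J →ₗ[ℝ] ℝ}
    (hT : ∀ p : J, IsPrimitiveIdempotent p → T p = 1) :
    IsNorm (fun u : LinearMap.ker T => specDiam (u : J)) :=
  ⟨Seminorm.of (fun u : LinearMap.ker T => specDiam (u : J))
    (fun x y => specDiam_add_le hreal (x : J) y) (fun c x => specDiam_smul hreal c (x : J)),
    fun _ => rfl, fun x h => Subtype.ext (eq_zero_of_specDiam_eq_zero hreal hT x.2 h)⟩

theorem mem_cone_iff {x : J} : x ∈ cone J ↔ maxEigenvalue (-x) < 0 := by
  constructor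
  · intro h
    have := h _ (neg_maxEigenvalue_neg_mem hreal x)
    linarith
  · intro h μ hμ
    have := neg_maxEigenvalue_neg_le hreal hμ
    linarith

theorem abs_maxEigenvalue_sub_le (x y : J) :
    |maxEigenvalue x - maxEigenvalue y| ≤ specNorm (x - y) := by
  have h1 := maxEigenvalue_add_le hreal (x - y) y
  have h2 := maxEigenvalue_add_le hreal (-(x - y)) x
  rw [sub_add_cancel] at h1
  rw [neg_sub, sub_add_cancel] at h2
  rw [specNorm_eq hreal, abs_le', neg_sub x y]
  exact ⟨le_max_of_le_left (by linarith), le_max_of_le_right (by linarith)⟩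

/-! ### First-order expansion of the exponential and the limits -/

theorem maxEigenvalue_neg_exp_nonpos (x : J) : maxEigenvalue (-exp x) ≤ 0 := by
  have h := nonempty_spectralDecomposition hreal x
  rw [exp, dif_pos h, ← Finset.sum_neg_distrib]
  simp only [← neg_smul]
  exact maxEigenvalue_sum_le hreal h.some.isJordanFrame fun i =>
    neg_nonpos.mpr (Real.exp_pos _).le

/-- The scalar bound `|e^λ - 1 - λ| ≤ λ²` is applied along the very decomposition that defines `exp
x`, so independence of that choice is not needed. -/
theorem specNorm_exp_sub_le {e : J} (he : ∀ y, e * y = y) {x : J} (hx : specNorm x ≤ 1) :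
    specNorm (exp x - e - x) ≤ specNorm x ^ 2 := by
  have h := nonempty_spectralDecomposition hreal x
  obtain ⟨d, hd⟩ : ∃ d, d = h.some := ⟨_, rfl⟩
  have hunit : ∑ i, d.frame i = e := by
    have h1 := d.isJordanFrame.2.2 e
    rwa [mul_comm, he] at h1
  have hval : exp x - e - x
      = ∑ i, (Real.exp (d.eigenvalue i) - 1 - d.eigenvalue i) • d.frame i := by
    rw [exp, dif_pos h, ← hd, ← hunit]
    conv_lhs => rhs; rw [d.eq_sum]
    simp only [sub_smul, Finset.sum_sub_distrib, one_smul]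
  have hb : ∀ i, |Real.exp (d.eigenvalue i) - 1 - d.eigenvalue i| ≤ specNorm x ^ 2 := fun i => by
    have h1 := abs_le_specNorm hreal (⟨d, i, rfl⟩ : d.eigenvalue i ∈ spec x)
    refine (Real.abs_exp_sub_one_sub_id_le (h1.trans hx)).trans ?_
    rw [← sq_abs]
    gcongr
  rw [specNorm_eq hreal, hval, ← Finset.sum_neg_distrib]
  simp only [← neg_smul]
  exact max_le
    (maxEigenvalue_sum_le hreal d.isJordanFrame fun i => (le_abs_self _).trans (hb i))
    (maxEigenvalue_sum_le hreal d.isJordanFrame fun i => (neg_le_abs _).trans (hb i))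

theorem specNorm_nonneg (x : J) : 0 ≤ specNorm x :=
  (abs_nonneg _).trans (abs_le_specNorm hreal (isGreatest_maxEigenvalue hreal x).1)

theorem tendsto_specNorm_exp {e : J} (he : ∀ y, e * y = y) (u : J) :
    Tendsto (fun t : ℝ => specNorm (t⁻¹ • (exp (t • u) - e) - u)) (𝓝[>] 0) (𝓝 0) := by
  have hlim : Tendsto (fun t : ℝ => t * specNorm u ^ 2) (𝓝[>] 0) (𝓝 0) := by
    have : Tendsto (fun t : ℝ => t * specNorm u ^ 2) (𝓝 0) (𝓝 (0 * specNorm u ^ 2)) :=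
      (continuous_id.mul continuous_const).tendsto 0
    rw [zero_mul] at this
    exact this.mono_left nhdsWithin_le_nhds
  have hsmall : ∀ᶠ t : ℝ in 𝓝[>] 0, t * specNorm u < 1 := by
    have : Tendsto (fun t : ℝ => t * specNorm u) (𝓝 0) (𝓝 (0 * specNorm u)) :=
      (continuous_id.mul continuous_const).tendsto 0
    rw [zero_mul] at this
    exact (this.mono_left nhdsWithin_le_nhds).eventually_lt_const one_pos
  refine squeeze_zero' (Eventually.of_forall fun t => specNorm_nonneg hreal _) ?_ hlim
  filter_upwards [hsmall, self_mem_nhdsWithin] with t ht ht0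
  have ht0 : 0 < t := ht0
  have hn : specNorm (t • u) = t * specNorm u := by rw [specNorm_smul hreal, abs_of_pos ht0]
  have h1 := specNorm_exp_sub_le hreal he (x := t • u) (by rw [hn]; exact ht.le)
  have h2 : t⁻¹ • (exp (t • u) - e) - u = t⁻¹ • (exp (t • u) - e - t • u) := by
    rw [smul_sub _ (exp (t • u) - e), inv_smul_smul₀ ht0.ne']
  rw [h2, specNorm_smul hreal, abs_of_pos (inv_pos.mpr ht0)]
  calc t⁻¹ * specNorm (exp (t • u) - e - t • u) ≤ t⁻¹ * (t * specNorm u) ^ 2 := by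
        rw [← hn]; exact mul_le_mul_of_nonneg_left h1 (inv_pos.mpr ht0).le
    _ = t * specNorm u ^ 2 := by field_simp

/-- First-order expansion of the largest eigenvalue of `exp (t u) - e^{ts} exp (t v)`. -/
theorem tendsto_maxEigenvalue_exp_sub (u v : J) (s : ℝ) :
    Tendsto (fun t : ℝ => t⁻¹ * maxEigenvalue (exp (t • u) - Real.exp (t * s) • exp (t • v)))
      (𝓝[>] 0) (𝓝 (maxEigenvalue (u - v) - s)) := by
  obtain ⟨e, he⟩ := exists_unit hreal
  have hexp1 : Tendsto (fun t : ℝ => Real.exp (t * s)) (𝓝[>] 0) (𝓝 1) := by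
    have : Tendsto (fun t : ℝ => Real.exp (t * s)) (𝓝 0) (𝓝 (Real.exp (0 * s))) :=
      (Real.continuous_exp.comp (continuous_id.mul continuous_const)).tendsto 0
    rw [zero_mul, Real.exp_zero] at this
    exact this.mono_left nhdsWithin_le_nhds
  have hexp2 : Tendsto (fun t : ℝ => t⁻¹ * (Real.exp (t * s) - 1)) (𝓝[>] 0) (𝓝 s) := by
    have hd : HasDerivAt (fun t : ℝ => Real.exp (t * s)) s 0 := by
      have := ((hasDerivAt_id (0 : ℝ)).mul_const s).exp
      simpa using this
    have := hd.tendsto_slope_zero_right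
    simpa using this
  have hbound : Tendsto (fun t : ℝ => specNorm (t⁻¹ • (exp (t • u) - e) - u)
      + Real.exp (t * s) * specNorm (t⁻¹ • (exp (t • v) - e) - v)
      + |Real.exp (t * s) - 1| * specNorm v
      + |t⁻¹ * (Real.exp (t * s) - 1) - s| * specNorm e) (𝓝[>] 0) (𝓝 0) := by
    have h := (((tendsto_specNorm_exp hreal he u).add
      (hexp1.mul (tendsto_specNorm_exp hreal he v))).add
      ((hexp1.sub_const 1).abs.mul_const (specNorm v))).add
      ((hexp2.sub_const s).abs.mul_const (specNorm e))
    simpa using h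
  -- Subadditivity used in both directions shows that subtracting `s e` shifts `Λ` by exactly `s`.
  have hmain : maxEigenvalue (u - v - s • e) = maxEigenvalue (u - v) - s := by
    have h1 := maxEigenvalue_add_le hreal (u - v) ((-s) • e)
    have h2 := maxEigenvalue_add_le hreal (u - v - s • e) (s • e)
    rw [maxEigenvalue_smul_unit hreal he, neg_smul, ← sub_eq_add_neg] at h1
    rw [maxEigenvalue_smul_unit hreal he, sub_add_cancel] at h2
    linarith
  rw [← hmain, tendsto_iff_dist_tendsto_zero]
  refine squeeze_zero' (Eventually.of_forall fun t => dist_nonneg) ?_ hbound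
  filter_upwards [self_mem_nhdsWithin] with t ht0
  have ht0 : 0 < t := ht0
  rw [← maxEigenvalue_smul hreal (inv_pos.mpr ht0), Real.dist_eq]
  refine (abs_maxEigenvalue_sub_le hreal _ _).trans ?_
  set E := Real.exp (t * s) with hE
  have hEpos : |E| = E := abs_of_pos (Real.exp_pos _)
  have hdec : t⁻¹ • (exp (t • u) - E • exp (t • v)) - (u - v - s • e)
      = (t⁻¹ • (exp (t • u) - e) - u) + -(E • (t⁻¹ • (exp (t • v) - e) - v))
        + -((E - 1) • v) + -((t⁻¹ * (E - 1) - s) • e) := by module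
  rw [hdec]
  refine (specNorm_add_le hreal _ _).trans (add_le_add ((specNorm_add_le hreal _ _).trans
    (add_le_add ((specNorm_add_le hreal _ _).trans (add_le_add le_rfl ?_)) ?_)) ?_)
  · rw [specNorm_neg hreal, specNorm_smul hreal, hEpos]
  · rw [specNorm_neg hreal, specNorm_smul hreal]
  · rw [specNorm_neg hreal, specNorm_smul hreal]

/-- The rescaled `Λ` tends to `-ε` at the exponent `m + ε` and to `ε` at `m - ε`: the first scalar
is eventually admissible, the second is not. -/
theorem eventually_gaugeM_exp_mem (u v : J) {ε : ℝ} (hε : 0 < ε) :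
    ∀ᶠ t : ℝ in 𝓝[>] 0, gaugeM (exp (t • u)) (exp (t • v)) ∈
      Set.Icc (Real.exp (t * (maxEigenvalue (u - v) - ε)))
        (Real.exp (t * (maxEigenvalue (u - v) + ε))) := by
  set m := maxEigenvalue (u - v)
  have hup := (tendsto_maxEigenvalue_exp_sub hreal u v (m + ε)).eventually_lt_const
    (show m - (m + ε) < 0 by linarith)
  have hlo := (tendsto_maxEigenvalue_exp_sub hreal u v (m - ε)).eventually_const_lt
    (show 0 < m - (m - ε) by linarith)
  filter_upwards [hup, hlo, self_mem_nhdsWithin] with t hup hlo ht0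
  have ht0 : 0 < t⁻¹ := inv_pos.mpr ht0
  have hup : maxEigenvalue (exp (t • u) - Real.exp (t * (m + ε)) • exp (t • v)) < 0 := by
    by_contra h
    exact absurd hup (not_lt.mpr (mul_nonneg ht0.le (not_lt.mp h)))
  have hlo : 0 < maxEigenvalue (exp (t • u) - Real.exp (t * (m - ε)) • exp (t • v)) :=
    pos_of_mul_pos_right hlo ht0.le
  have hmem : Real.exp (t * (m + ε)) ∈
      {c : ℝ | 0 < c ∧ c • exp (t • v) - exp (t • u) ∈ cone J} :=
    ⟨Real.exp_pos _, by rwa [mem_cone_iff hreal, neg_sub]⟩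
  have hlb : ∀ c ∈ {c : ℝ | 0 < c ∧ c • exp (t • v) - exp (t • u) ∈ cone J},
      Real.exp (t * (m - ε)) ≤ c := by
    rintro c ⟨-, hc⟩
    rw [mem_cone_iff hreal, neg_sub] at hc
    -- Admissibility passes to larger scalars, because `Λ (-exp (t v)) ≤ 0`; so an admissible `c`
    -- below the bound would make `hlo` fail.
    by_contra hlt
    have hlt := sub_pos.mpr (not_le.mp hlt)
    have h1 := maxEigenvalue_add_le hreal (exp (t • u) - c • exp (t • v))
      ((Real.exp (t * (m - ε)) - c) • -exp (t • v))
    rw [maxEigenvalue_smul hreal hlt, show exp (t • u) - c • exp (t • v)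
      + (Real.exp (t * (m - ε)) - c) • -exp (t • v)
      = exp (t • u) - Real.exp (t * (m - ε)) • exp (t • v) by module] at h1
    have h2 := mul_nonpos_of_nonneg_of_nonpos hlt.le (maxEigenvalue_neg_exp_nonpos hreal (t • v))
    linarith
  exact ⟨le_csInf ⟨_, hmem⟩ hlb, csInf_le ⟨_, hlb⟩ hmem⟩

theorem eventually_gaugeM_exp_pos (u v : J) :
    ∀ᶠ t : ℝ in 𝓝[>] 0, 0 < gaugeM (exp (t • u)) (exp (t • v)) :=
  (eventually_gaugeM_exp_mem hreal u v one_pos).mono fun _ h => (Real.exp_pos _).trans_le h.1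

theorem tendsto_log_gaugeM_exp (u v : J) :
    Tendsto (fun t : ℝ => Real.log (gaugeM (exp (t • u)) (exp (t • v))) / t) (𝓝[>] 0)
      (𝓝 (maxEigenvalue (u - v))) := by
  rw [Metric.tendsto_nhds]
  intro ε hε
  filter_upwards [eventually_gaugeM_exp_mem hreal u v (half_pos hε), self_mem_nhdsWithin]
    with t ht ht0
  have ht0 : 0 < t := ht0
  have hpos := (Real.exp_pos _).trans_le ht.1
  have h1 := (Real.le_log_iff_exp_le hpos).mpr ht.1
  have h2 := (Real.log_le_iff_le_exp hpos).mpr ht.2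
  rw [mul_comm, ← le_div_iff₀ ht0] at h1
  rw [mul_comm, ← div_le_iff₀ ht0] at h2
  rw [Real.dist_eq, abs_lt]
  constructor <;> linarith

theorem tendsto_thompsonScaled (u v : J) :
    Tendsto (fun t : ℝ => thompsonScaled t u v) (𝓝[>] 0) (𝓝 (specNorm (v - u))) := by
  rw [specNorm_eq hreal, neg_sub, max_comm]
  refine ((tendsto_log_gaugeM_exp hreal u v).max (tendsto_log_gaugeM_exp hreal v u)).congr' ?_
  filter_upwards [eventually_gaugeM_exp_pos hreal u v, eventually_gaugeM_exp_pos hreal v u,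
    self_mem_nhdsWithin] with t h1 h2 ht0
  have ht0 : 0 < t := ht0
  rw [thompsonScaled, thompson, max_div_div_right ht0.le]
  rcases le_total (gaugeM (exp (t • u)) (exp (t • v))) (gaugeM (exp (t • v)) (exp (t • u)))
    with h | h
  · rw [max_eq_right h, max_eq_right (Real.log_le_log h1 h)]
  · rw [max_eq_left h, max_eq_left (Real.log_le_log h2 h)]

theorem tendsto_hilbertScaled (u v : J) :
    Tendsto (fun t : ℝ => hilbertScaled t u v) (𝓝[>] 0) (𝓝 (specDiam (u - v))) := by
  rw [specDiam_eq hreal, neg_sub]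
  refine ((tendsto_log_gaugeM_exp hreal u v).add (tendsto_log_gaugeM_exp hreal v u)).congr' ?_
  filter_upwards [eventually_gaugeM_exp_pos hreal u v, eventually_gaugeM_exp_pos hreal v u]
    with t h1 h2
  rw [hilbertScaled, hilbert, Real.log_mul h1.ne' h2.ne', add_div]

end Order

/-! ### The zero algebra -/

section Subsingleton

variable {J : Type*} [NonUnitalNonAssocCommRing J] [Module ℝ J] [Subsingleton J]

theorem spec_eq_empty (x : J) : spec x = ∅ := by
  rw [Set.eq_empty_iff_forall_notMem]
  rintro μ ⟨d, i, -⟩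
  exact (d.isJordanFrame.1 i).2.1 (Subsingleton.elim _ _)

theorem specNorm_of_subsingleton (x : J) : specNorm x = 0 := by
  simp [specNorm, spec_eq_empty]

theorem specDiam_of_subsingleton (x : J) : specDiam x = 0 := by
  simp [specDiam, spec_eq_empty]

/-- The cone is everything, so the infimum runs over all `t > 0`; the metrics then vanish by the
convention `log 0 = 0`. -/
theorem gaugeM_of_subsingleton (P Q : J) : gaugeM P Q = 0 := by
  have : {t : ℝ | 0 < t ∧ t • Q - P ∈ cone J} = Set.Ioi 0 := by
    ext t
    simp [cone, spec_eq_empty]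
  rw [gaugeM, this, csInf_Ioi]

theorem isNorm_zero {E : Type*} [AddCommGroup E] [Module ℝ E] [Subsingleton E] {N : E → ℝ}
    (hN : ∀ x, N x = 0) : IsNorm N :=
  ⟨0, fun x => by rw [hN]; rfl, fun _ _ => Subsingleton.elim _ _⟩

end Subsingleton

end EuclideanJordan

theorem mainTheorem8 {J : Type*} [NonUnitalNonAssocCommRing J] [Module ℝ J]
    [IsScalarTower ℝ J J] [SMulCommClass ℝ J J] [FiniteDimensional ℝ J] [IsCommJordan J]
    (hreal : ∀ a b : J, a * a + b * b = 0 → a = 0 ∧ b = 0) :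
    EuclideanJordan.IsNorm (fun u : J => EuclideanJordan.specNorm u) ∧
    (∀ u v : J, Tendsto (fun t : ℝ => EuclideanJordan.thompsonScaled t u v) (𝓝[>] 0)
      (𝓝 (EuclideanJordan.specNorm (v - u)))) ∧
    ∃ J₀ : Submodule ℝ J, (∀ u : J, u ∈ J₀ ↔ EuclideanJordan.trace u = 0) ∧
      EuclideanJordan.IsNorm (fun u : J₀ => EuclideanJordan.specDiam (u : J)) ∧
      ∀ u₀ v₀ : J₀, Tendsto (fun t : ℝ => EuclideanJordan.hilbertScaled t (u₀ : J) (v₀ : J))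
        (𝓝[>] 0) (𝓝 (EuclideanJordan.specDiam ((u₀ : J) - (v₀ : J)))) := by
  obtain ⟨T, htr, hT⟩ := EuclideanJordan.exists_trace_eq_linear hreal
  have hker : ∀ u : J, u ∈ LinearMap.ker T ↔ EuclideanJordan.trace u = 0 := fun u => by
    rw [LinearMap.mem_ker, htr]
  rcases subsingleton_or_nontrivial J with _ | _
  · refine ⟨EuclideanJordan.isNorm_zero EuclideanJordan.specNorm_of_subsingleton, fun u v => ?_,
      LinearMap.ker T, hker,
      EuclideanJordan.isNorm_zero fun u => EuclideanJordan.specDiam_of_subsingleton (u : J),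
      fun u v => ?_⟩
    · simp [EuclideanJordan.thompsonScaled, EuclideanJordan.thompson,
        EuclideanJordan.gaugeM_of_subsingleton, EuclideanJordan.specNorm_of_subsingleton]
    · simp [EuclideanJordan.hilbertScaled, EuclideanJordan.hilbert,
        EuclideanJordan.gaugeM_of_subsingleton, EuclideanJordan.specDiam_of_subsingleton]
  · exact ⟨EuclideanJordan.isNorm_specNorm hreal, EuclideanJordan.tendsto_thompsonScaled hreal,
      LinearMap.ker T, hker, EuclideanJordan.isNorm_specDiam hreal hT,
      fun u v => EuclideanJordan.tendsto_hilbertScaled hreal (u : J) v⟩
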